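/- Let $m\ge 1$ and $\boldsymbol p=(p_0,\dots,p_{m-1})\in(0,1)^m$. The cyclic birth and death chain with parameter $\boldsymbol p$ is the Markov chain $X=(X_n)_{n\ge0}$ on $\mathbb Z$ that jumps from $x$ to $x+1$ with probability $p_{x \bmod m}$ and from $x$ to $x-1$ with probability $1-p_{x\bmod m}$. Its speed $v(\boldsymbol p)$ is the deterministic number with $X_n/n\to v(\boldsymbol p)$ almost surely, whatever the starting point. For a permutation $\sigma$ of $\{0,\dots,m-1\}$ put $\boldsymbol p_\sigma=(p_{\sigma^{-1}(i)})_{i=0}^{m-1}$. The greedy permutation $\sigma_{\mathrm{greedy}}$ is the permutation with $\sigma_{\mathrm{greedy}}^{-1}(i)=2i$ for all $i\ge 0$ with $2i<m$ and $\sigma_{\mathrm{greedy}}^{-1}(m-1-i)=2i+1$ for all $i\ge 0$ with $2i+1<m$, so that $\boldsymbol p_{\sigma_{\mathrm{greedy}}}=(p_0,p_2,p_4,\dots,p_5,p_3,p_1)$. Suppose that $1\le m\le 7$, that $p_0\ge p_1\ge\dots\ge p_{m-1}$, and that $\gamma=\prod_{i=0}^{m-1}\frac{1-p_i}{p_i}<1$.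 Then for every permutation $\sigma$ of $\{0,\dots,m-1\}$ the speed $v(\boldsymbol p_\sigma)$ exists and is positive, and $$v(\boldsymbol p_{\sigma_{\mathrm{greedy}}})\le v(\boldsymbol p_\sigma).$$ -/

import Mathlib

open MeasureTheory ProbabilityTheory

/-- The residue of an integer modulo `m`, as an element of `{0, …, m - 1}`. -/
def residue (m : ℕ) [NeZero m] (x : ℤ) : Fin m :=
  ⟨(x % (m : ℤ)).toNat, by
    have hm : (0 : ℤ) < (m : ℤ) := by exact_mod_cast Nat.pos_of_ne_zero (NeZero.ne m)
    have h0 := Int.emod_nonneg x hm.ne'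
    have h1 := Int.emod_lt_of_pos x hm
    omega⟩

/-- One step of the cyclic birth and death chain with birth probabilities `p`: from `x ∈ ℤ` jump to
`x + 1` with probability `p (x mod m)` and to `x - 1` with the complementary probability. -/
noncomputable def stepMeasure {m : ℕ} [NeZero m] (p : Fin m → Set.Ioo (0 : ℝ) 1) (x : ℤ) :
    Measure ℤ :=
  ENNReal.ofReal (p (residue m x) : ℝ) • Measure.dirac (x + 1) +
    ENNReal.ofReal (1 - (p (residue m x) : ℝ)) • Measure.dirac (x - 1)

theorem isProbabilityMeasure_stepMeasure {m : ℕ} [NeZero m] (p : Fin m → Set.Ioo (0 : ℝ) 1)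
    (x : ℤ) : IsProbabilityMeasure (stepMeasure p x) := by
  constructor
  have h := (p (residue m x)).2
  simp only [stepMeasure, Measure.add_apply, Measure.smul_apply, measure_univ, smul_eq_mul,
    mul_one]
  rw [← ENNReal.ofReal_add h.1.le (sub_nonneg.2 h.2.le)]
  simp

/-- The transition kernel on `ℤ` of the cyclic birth and death chain. -/
noncomputable def stepKernel {m : ℕ} [NeZero m] (p : Fin m → Set.Ioo (0 : ℝ) 1) : Kernel ℤ ℤ where
  toFun := stepMeasure p
  measurable' := measurable_of_countable _

instance instIsMarkovKernelStepKernel {m : ℕ} [NeZero m] (p : Fin m → Set.Ioo (0 : ℝ) 1) :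
    IsMarkovKernel (stepKernel p) :=
  ⟨fun x => isProbabilityMeasure_stepMeasure p x⟩

/-- The conditional law of `X (n + 1)` given `X 0, …, X n`: it is the transition kernel at `X n`. -/
noncomputable def historyKernel {m : ℕ} [NeZero m] (p : Fin m → Set.Ioo (0 : ℝ) 1) (n : ℕ) :
    Kernel (Finset.Iic n → ℤ) ℤ :=
  (stepKernel p).comap (fun h => h ⟨n, Finset.mem_Iic.2 le_rfl⟩) (measurable_pi_apply _)

instance instIsMarkovKernelHistoryKernel {m : ℕ} [NeZero m] (p : Fin m → Set.Ioo (0 : ℝ) 1)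
    (n : ℕ) : IsMarkovKernel (historyKernel p n) := by
  unfold historyKernel
  infer_instance

/-- The law, on trajectories `ℕ → ℤ`, of the cyclic birth and death chain with birth probabilities
`p` started at `x₀`. -/
noncomputable def chainLaw {m : ℕ} [NeZero m] (p : Fin m → Set.Ioo (0 : ℝ) 1) (x₀ : ℤ) :
    Measure (ℕ → ℤ) :=
  Kernel.trajMeasure (X := fun _ => ℤ) (Measure.dirac x₀) (historyKernel p)

/-- `v` is the velocity of the chain: for every starting point, `X n / n → v` almost surely. -/
def HasVelocity {m : ℕ} [NeZero m] (p : Fin m → Set.Ioo (0 : ℝ) 1) (v : ℝ) : Prop :=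
  ∀ x₀ : ℤ, ∀ᵐ X ∂(chainLaw p x₀),
    Filter.Tendsto (fun n : ℕ => (X n : ℝ) / (n : ℝ)) Filter.atTop (nhds v)

/-- `γ(p) = ∏ i, ρ i` with `ρ i = (1 - p i) / p i`. -/
noncomputable def gammaProd {m : ℕ} (p : Fin m → Set.Ioo (0 : ℝ) 1) : ℝ :=
  ∏ i : Fin m, (1 - (p i : ℝ)) / (p i : ℝ)

/-- The reordering `p_σ = (p (σ⁻¹ i))_i`. -/
def reorder {m : ℕ} (p : Fin m → Set.Ioo (0 : ℝ) 1) (σ : Equiv.Perm (Fin m)) :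
    Fin m → Set.Ioo (0 : ℝ) 1 :=
  fun i => p (σ⁻¹ i)

/-- The inverse of the greedy permutation: `i ↦ 2 i` if `2 i < m`, and
`m - 1 - i ↦ 2 i + 1` if `2 i + 1 < m`. -/
def greedyInv (m : ℕ) (i : Fin m) : Fin m :=
  if h : 2 * (i : ℕ) < m then ⟨2 * (i : ℕ), h⟩
  else ⟨2 * (m - 1 - (i : ℕ)) + 1, by have := i.2; omega⟩

theorem greedyInv_injective (m : ℕ) : Function.Injective (greedyInv m) := by
  intro i j hij
  have hi := i.2
  have hj := j.2
  unfold greedyInv at hij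
  split_ifs at hij <;> rw [Fin.mk.injEq] at hij <;> apply Fin.ext <;> omega

/-- The greedy permutation, so that `p_σ = (p 0, p 2, p 4, …, p 5, p 3, p 1)`. -/
noncomputable def greedyPerm (m : ℕ) : Equiv.Perm (Fin m) :=
  (Equiv.ofBijective (greedyInv m)
    (Finite.injective_iff_bijective.1 (greedyInv_injective m)))⁻¹

/-! Let `ρ i = (1 - p i) / p i`, so that `γ = ∏ ρ i`. The mean time to climb by one period is `N /
(1 - γ)`, where `N` adds up products of `ρ` over arcs of the cycle. Hence the speed is `m (1 - γ) /
N` (`hasVelocity_formula`). This is proved by a corrector: the periodic mean passage times are the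
increments of a function `h` at bounded distance from the identity, and `h (X n) - n v` is a
martingale with bounded increments, controlled by exponential moments.

Permuting `p` leaves `γ` unchanged, so the slowest arrangement is the one with the largest `N`. For
each arc length the greedy order maximizes the arc sum (`arcSum_comp_le_arcSum_comp_greedyInv`).
Indeed, polarization by a reflection of the cycle does not decrease any arc sum
(`IsPolarization.arcSum_le`), and the only arrangement polarized for two suitable adjacent
reflections is the greedy one (`eq_greedyInv_of_polarized`). -/

section Velocity

/-! ### A law of large numbers from a bounded corrector. -/

variable {m : ℕ} [NeZero m] (p : Fin m → Set.Ioo (0 : ℝ) 1)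

instance instIsProbabilityMeasureChainLaw (x₀ : ℤ) : IsProbabilityMeasure (chainLaw p x₀) := by
  unfold chainLaw
  infer_instance

theorem lintegral_stepMeasure (x : ℤ) (f : ℤ → ENNReal) :
    ∫⁻ y, f y ∂stepMeasure p x =
      ENNReal.ofReal (p (residue m x)) * f (x + 1) +
        ENNReal.ofReal (1 - p (residue m x)) * f (x - 1) := by
  simp [stepMeasure, lintegral_add_measure, lintegral_smul_measure]

theorem lintegral_chainLaw_zero (x₀ : ℤ) (f : ℤ → ENNReal) :
    ∫⁻ X, f (X 0) ∂chainLaw p x₀ = f x₀ := by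
  have hf : Measurable f := measurable_of_countable _
  have h : (chainLaw p x₀).map (Preorder.frestrictLe 0) =
      (Measure.dirac x₀).map
        (MeasurableEquiv.piUnique (fun i : Finset.Iic 0 => (fun _ : ℕ => ℤ) i)).symm := by
    rw [chainLaw, Kernel.trajMeasure, Measure.map_comp _ _ (by fun_prop),
      Kernel.traj_map_frestrictLe, Kernel.partialTraj_self, Measure.id_comp]
  have h1 : ∫⁻ X, f (X 0) ∂chainLaw p x₀ =
      ∫⁻ y, f (y ⟨0, Finset.mem_Iic.2 le_rfl⟩)
        ∂(chainLaw p x₀).map (Preorder.frestrictLe 0) := by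
    rw [lintegral_map (by fun_prop) (by fun_prop)]
    rfl
  rw [h1, h, lintegral_map (by fun_prop) (by fun_prop), lintegral_dirac]
  rfl

theorem lintegral_chainLaw_succ (x₀ : ℤ) (n : ℕ) (f : ℤ → ENNReal) :
    ∫⁻ X, f (X (n + 1)) ∂chainLaw p x₀ =
      ∫⁻ X, (∫⁻ y, f y ∂stepMeasure p (X n)) ∂chainLaw p x₀ := by
  have hf : Measurable f := measurable_of_countable _
  have hg : Measurable (fun x : ℤ => ∫⁻ y, f y ∂stepMeasure p x) := measurable_of_countable _
  have h := Kernel.map_frestrictLe_trajMeasure_compProd_eq_map_trajMeasure (X := fun _ => ℤ)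
    (κ := historyKernel p) (μ₀ := Measure.dirac x₀) (a := n)
  have h1 : ∫⁻ X, f (X (n + 1)) ∂chainLaw p x₀ =
      ∫⁻ z, f z.2 ∂(chainLaw p x₀).map (fun X => (Preorder.frestrictLe n X, X (n + 1))) := by
    rw [lintegral_map (by fun_prop) (by fun_prop)]
  rw [h1, chainLaw, ← h, Measure.lintegral_compProd (by fun_prop)]
  change ∫⁻ a : Finset.Iic n → ℤ, ∫⁻ y, f y ∂stepMeasure p (a ⟨n, Finset.mem_Iic.2 le_rfl⟩) ∂_ = _
  rw [lintegral_map (by fun_prop) (by fun_prop)]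
  rfl

theorem exp_le_one_add_add_sq {y : ℝ} (hy : |y| ≤ 1) : Real.exp y ≤ 1 + y + y ^ 2 := by
  have := (abs_le.1 (Real.abs_exp_sub_one_sub_id_le hy)).2
  linarith

/-- A centred two-point law on `[-c, c]` is subgaussian for small parameters. -/
theorem two_point_mgf_le {q a b c t : ℝ} (hq0 : 0 ≤ q) (hq1 : q ≤ 1)
    (hmean : q * a + (1 - q) * b = 0) (ha : |a| ≤ c) (hb : |b| ≤ c) (htc : |t| * c ≤ 1) :
    q * Real.exp (t * a) + (1 - q) * Real.exp (t * b) ≤ Real.exp (t ^ 2 * c ^ 2) := by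
  have key : ∀ y : ℝ, |y| ≤ c → Real.exp (t * y) ≤ 1 + t * y + t ^ 2 * c ^ 2 := by
    intro y hy
    have h1 : |t * y| ≤ 1 := by
      rw [abs_mul]
      exact (mul_le_mul_of_nonneg_left hy (abs_nonneg t)).trans htc
    have h2 : y ^ 2 ≤ c ^ 2 := sq_le_sq' (by linarith [(abs_le.1 hy).1]) (abs_le.1 hy).2
    calc Real.exp (t * y) ≤ 1 + t * y + (t * y) ^ 2 := exp_le_one_add_add_sq h1
      _ ≤ _ := by
        rw [mul_pow]
        gcongr
  calc q * Real.exp (t * a) + (1 - q) * Real.exp (t * b)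
      ≤ q * (1 + t * a + t ^ 2 * c ^ 2) + (1 - q) * (1 + t * b + t ^ 2 * c ^ 2) :=
        add_le_add (mul_le_mul_of_nonneg_left (key a ha) hq0)
          (mul_le_mul_of_nonneg_left (key b hb) (by linarith))
    _ = t ^ 2 * c ^ 2 + 1 := by linear_combination t * hmean
    _ ≤ _ := Real.add_one_le_exp _

variable {p}

section Martingale

variable {h : ℤ → ℝ} {v c : ℝ}
  (hmg : ∀ x, (p (residue m x) : ℝ) * (h (x + 1) - h x - v) +
    (1 - (p (residue m x) : ℝ)) * (h (x - 1) - h x - v) = 0)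
  (hup : ∀ x, |h (x + 1) - h x - v| ≤ c) (hdown : ∀ x, |h (x - 1) - h x - v| ≤ c)

include hmg hup hdown

/-- The section hypotheses say that `h (X n) - n v` is a martingale with increments at most `c`.
Each step therefore multiplies the exponential moment by at most `exp (t v + t² c²)`. -/
theorem lintegral_exp_le (x₀ : ℤ) {t : ℝ} (htc : |t| * c ≤ 1) (n : ℕ) :
    ∫⁻ X, ENNReal.ofReal (Real.exp (t * h (X n))) ∂chainLaw p x₀ ≤
      ENNReal.ofReal (Real.exp (t * h x₀ + n * (t * v + t ^ 2 * c ^ 2))) := by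
  induction n with
  | zero =>
    rw [lintegral_chainLaw_zero p x₀ (fun x => ENNReal.ofReal (Real.exp (t * h x)))]
    simp
  | succ n ih =>
    rw [lintegral_chainLaw_succ p x₀ n (fun x => ENNReal.ofReal (Real.exp (t * h x)))]
    have hstep : ∀ x : ℤ, ∫⁻ y, ENNReal.ofReal (Real.exp (t * h y)) ∂stepMeasure p x ≤
        ENNReal.ofReal (Real.exp (t * v + t ^ 2 * c ^ 2)) *
          ENNReal.ofReal (Real.exp (t * h x)) := by
      intro x
      have hp := (p (residue m x)).2
      have hp1 : (0 : ℝ) ≤ 1 - p (residue m x) := sub_nonneg.2 hp.2.le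
      rw [lintegral_stepMeasure, ← ENNReal.ofReal_mul hp.1.le, ← ENNReal.ofReal_mul hp1,
        ← ENNReal.ofReal_add (mul_nonneg hp.1.le (Real.exp_nonneg _))
          (mul_nonneg hp1 (Real.exp_nonneg _)), ← ENNReal.ofReal_mul (Real.exp_nonneg _)]
      apply ENNReal.ofReal_le_ofReal
      have h2 := two_point_mgf_le hp.1.le hp.2.le (hmg x) (hup x) (hdown x) htc
      have e1 : Real.exp (t * h (x + 1)) =
          Real.exp (t * (h (x + 1) - h x - v)) * Real.exp (t * v + t * h x) := by
        rw [← Real.exp_add]; ring_nf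
      have e2 : Real.exp (t * h (x - 1)) =
          Real.exp (t * (h (x - 1) - h x - v)) * Real.exp (t * v + t * h x) := by
        rw [← Real.exp_add]; ring_nf
      have e3 : Real.exp (t * v + t ^ 2 * c ^ 2) * Real.exp (t * h x) =
          Real.exp (t ^ 2 * c ^ 2) * Real.exp (t * v + t * h x) := by
        rw [← Real.exp_add, ← Real.exp_add]; ring_nf
      rw [e1, e2, e3, ← mul_assoc, ← mul_assoc, ← add_mul]
      exact mul_le_mul_of_nonneg_right h2 (Real.exp_nonneg _)
    have hle : ∫⁻ X, (∫⁻ y, ENNReal.ofReal (Real.exp (t * h y)) ∂stepMeasure p (X n))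
        ∂chainLaw p x₀ ≤ ∫⁻ X, ENNReal.ofReal (Real.exp (t * v + t ^ 2 * c ^ 2)) *
          ENNReal.ofReal (Real.exp (t * h (X n))) ∂chainLaw p x₀ := by
      apply lintegral_mono
      intro X
      exact hstep (X n)
    refine hle.trans ?_
    rw [lintegral_const_mul' _ _ ENNReal.ofReal_ne_top]
    refine (mul_le_mul_right ih _).trans ?_
    rw [← ENNReal.ofReal_mul (Real.exp_nonneg _), ← Real.exp_add]
    apply le_of_eq
    push_cast
    ring_nf

/-- Borel–Cantelli in summed form: allowing the rate `2 t² c²`, twice that of the moment bound,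
makes the expectations geometric. The series is then almost surely finite, its terms are eventually
below `1`, and their exponents are negative. -/
theorem ae_eventually_le (x₀ : ℤ) {t : ℝ} (ht : t ≠ 0) (hc : 0 < c) (htc : |t| * c ≤ 1) :
    ∀ᵐ X ∂chainLaw p x₀, ∀ᶠ n : ℕ in Filter.atTop,
      t * (h (X n) - n * v) ≤ 2 * t ^ 2 * c ^ 2 * n := by
  have hmeas : ∀ (n : ℕ) (a : ℝ), Measurable fun X : ℕ → ℤ =>
      ENNReal.ofReal (Real.exp (t * h (X n) - a)) := fun n a =>
    (measurable_of_countable fun x : ℤ => ENNReal.ofReal (Real.exp (t * h x - a))).comp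
      (measurable_pi_apply n)
  have hr : 0 < t ^ 2 * c ^ 2 := by positivity
  have hfin : ∫⁻ X, ∑' n : ℕ,
      ENNReal.ofReal (Real.exp (t * h (X n) - n * (t * v + 2 * t ^ 2 * c ^ 2)))
        ∂chainLaw p x₀ ≠ ⊤ := by
    rw [lintegral_tsum fun n => (hmeas n _).aemeasurable]
    have hsum : Summable fun n : ℕ =>
        Real.exp (t * h x₀) * Real.exp (-(t ^ 2 * c ^ 2)) ^ n :=
      (summable_geometric_of_lt_one (Real.exp_nonneg _)
        (Real.exp_lt_one_iff.2 (by linarith))).mul_left _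
    refine ne_top_of_le_ne_top hsum.tsum_ofReal_ne_top (ENNReal.tsum_le_tsum fun n => ?_)
    have e : ∀ X : ℕ → ℤ,
        ENNReal.ofReal (Real.exp (t * h (X n) - n * (t * v + 2 * t ^ 2 * c ^ 2))) =
          ENNReal.ofReal (Real.exp (-(n * (t * v + 2 * t ^ 2 * c ^ 2)))) *
            ENNReal.ofReal (Real.exp (t * h (X n))) := by
      intro X
      rw [← ENNReal.ofReal_mul (Real.exp_nonneg _), ← Real.exp_add]
      ring_nf
    simp_rw [e]
    rw [lintegral_const_mul' _ _ ENNReal.ofReal_ne_top]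
    refine (mul_le_mul_right (lintegral_exp_le hmg hup hdown x₀ htc n) _).trans ?_
    rw [← ENNReal.ofReal_mul (Real.exp_nonneg _), ← Real.exp_add, ← Real.exp_nat_mul,
      ← Real.exp_add]
    apply le_of_eq
    ring_nf
  have hae := ae_lt_top (Measurable.tsum fun n => hmeas n _) hfin
  filter_upwards [hae] with X hX
  have h0 := ENNReal.tendsto_atTop_zero_of_tsum_ne_top hX.ne
  filter_upwards [h0.eventually (gt_mem_nhds zero_lt_one)] with n hn
  rw [ENNReal.ofReal_lt_one, Real.exp_lt_one_iff] at hn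
  linarith

theorem ae_tendsto_div (x₀ : ℤ) (hc : 0 < c) {B : ℝ} (hB : ∀ x : ℤ, |h x - x| ≤ B) :
    ∀ᵐ X ∂chainLaw p x₀,
      Filter.Tendsto (fun n : ℕ => (X n : ℝ) / (n : ℝ)) Filter.atTop (nhds v) := by
  have hpos : ∀ k : ℕ, 0 < ((k : ℝ) + 1) * c := fun k => by positivity
  have hsmall : ∀ k : ℕ, 1 / (((k : ℝ) + 1) * c) * c ≤ 1 := by
    intro k
    have : 1 / (((k : ℝ) + 1) * c) * c = 1 / ((k : ℝ) + 1) := by field_simp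
    rw [this, div_le_one (by positivity)]
    have : (0 : ℝ) ≤ k := by positivity
    linarith
  have hplus : ∀ᵐ X ∂chainLaw p x₀, ∀ k : ℕ, ∀ᶠ n : ℕ in Filter.atTop,
      (1 / (((k : ℝ) + 1) * c)) * (h (X n) - n * v) ≤
        2 * (1 / (((k : ℝ) + 1) * c)) ^ 2 * c ^ 2 * n :=
    ae_all_iff.2 fun k => ae_eventually_le hmg hup hdown x₀ (one_div_pos.2 (hpos k)).ne' hc
      (by rw [abs_of_pos (one_div_pos.2 (hpos k))]; exact hsmall k)
  have hminus : ∀ᵐ X ∂chainLaw p x₀, ∀ k : ℕ, ∀ᶠ n : ℕ in Filter.atTop,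
      (-(1 / (((k : ℝ) + 1) * c))) * (h (X n) - n * v) ≤
        2 * (-(1 / (((k : ℝ) + 1) * c))) ^ 2 * c ^ 2 * n :=
    ae_all_iff.2 fun k => ae_eventually_le hmg hup hdown x₀
      (neg_ne_zero.2 (one_div_pos.2 (hpos k)).ne') hc
      (by rw [abs_neg, abs_of_pos (one_div_pos.2 (hpos k))]; exact hsmall k)
  filter_upwards [hplus, hminus] with X h1 h2
  rw [Metric.tendsto_atTop']
  intro ε hε
  -- With `t = ±1 / ((k + 1) c)` the deviation is at most `2 c n / (k + 1)`. The choice of `k` makes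
  -- this less than `ε n / 2`, and `N` makes `B` less than `ε n / 2`.
  obtain ⟨k, hk⟩ := exists_nat_gt (4 * c / ε)
  obtain ⟨N, hN⟩ := exists_nat_gt (2 * B / ε)
  have hev := (h1 k).and ((h2 k).and (Filter.eventually_gt_atTop (max N 1)))
  obtain ⟨n₀, hn₀⟩ := Filter.eventually_atTop.1 hev
  refine ⟨n₀, fun n hn => ?_⟩
  obtain ⟨a1, a2, a3⟩ := hn₀ n hn.le
  have hn0 : (0 : ℝ) < n := by
    have : 0 < n := by omega
    exact_mod_cast this
  have hNn : (N : ℝ) < n := by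
    have : N < n := by omega
    exact_mod_cast this
  have hk1 : 0 < (k : ℝ) + 1 := by positivity
  have b1 : h (X n) - n * v ≤ 2 * c / ((k : ℝ) + 1) * n := by
    have := mul_le_mul_of_nonneg_left a1 (hpos k).le
    field_simp at this ⊢
    linarith
  have b2 : -(h (X n) - n * v) ≤ 2 * c / ((k : ℝ) + 1) * n := by
    have := mul_le_mul_of_nonneg_left a2 (hpos k).le
    field_simp at this ⊢
    linarith
  have hc2 : 2 * c / ((k : ℝ) + 1) < ε / 2 := by
    rw [div_lt_iff₀ hε] at hk
    rw [div_lt_iff₀ hk1]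
    nlinarith
  have hB2 : B < ε / 2 * n := by
    rw [div_lt_iff₀ hε] at hN
    nlinarith
  have hBx := abs_le.1 (hB (X n))
  have b3 : 2 * c / ((k : ℝ) + 1) * n < ε / 2 * n := mul_lt_mul_of_pos_right hc2 hn0
  rw [Real.dist_eq, abs_lt]
  constructor
  · rw [neg_lt_sub_iff_lt_add, ← sub_lt_iff_lt_add', lt_div_iff₀ hn0]
    nlinarith
  · rw [sub_lt_iff_lt_add, div_lt_iff₀ hn0]
    nlinarith

end Martingale

theorem HasVelocity.unique {v w : ℝ} (hv : HasVelocity p v) (hw : HasVelocity p w) : v = w := by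
  obtain ⟨X, hX⟩ := ((hv 0).and (hw 0)).exists
  exact tendsto_nhds_unique hX.1 hX.2

end Velocity

/-! ### Residues of integers modulo `m`. -/

section Residue

variable {m : ℕ} [NeZero m]

theorem natCast_val_residue (x : ℤ) : ((residue m x : ℕ) : ℤ) = x % (m : ℤ) := by
  have hm : (m : ℤ) ≠ 0 := by exact_mod_cast NeZero.ne m
  exact Int.toNat_of_nonneg (Int.emod_nonneg x hm)

theorem residue_eq_iff {x y : ℤ} : residue m x = residue m y ↔ ∃ t : ℤ, x = y + t * m := by
  rw [Fin.ext_iff, ← Nat.cast_inj (R := ℤ), natCast_val_residue, natCast_val_residue]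
  constructor
  · intro h
    obtain ⟨t, ht⟩ := Int.ModEq.dvd (n := m) (a := y) (b := x) h.symm
    exact ⟨t, by linarith⟩
  · rintro ⟨t, rfl⟩
    exact Int.add_mul_emod_self_right y t m

@[simp]
theorem residue_natCast_val (i : Fin m) : residue m ((i : ℕ) : ℤ) = i := by
  rw [Fin.ext_iff, ← Nat.cast_inj (R := ℤ), natCast_val_residue]
  exact Int.emod_eq_of_lt (by positivity) (by exact_mod_cast i.2)

theorem residue_surjective : Function.Surjective (residue m) :=
  fun i => ⟨(i : ℕ), residue_natCast_val i⟩

theorem exists_eq_residue_add (x : ℤ) : ∃ t : ℤ, ((residue m x : ℕ) : ℤ) = x + t * m :=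
  residue_eq_iff.1 (residue_natCast_val (residue m x))

theorem residue_add_mul (x t : ℤ) : residue m (x + t * m) = residue m x :=
  residue_eq_iff.2 ⟨t, rfl⟩

theorem residue_sub_injOn (x : ℤ) :
    Set.InjOn (fun j : ℕ => residue m (x - j)) (Finset.range m) := by
  intro i hi j hj hij
  obtain ⟨t, ht⟩ := residue_eq_iff.1 hij
  have hi' := Finset.mem_range.1 (Finset.mem_coe.1 hi)
  have hj' := Finset.mem_range.1 (Finset.mem_coe.1 hj)
  have ht0 : t = 0 := by
    by_contra h
    rcases lt_or_gt_of_ne h with h | h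
    · have : t * (m : ℤ) ≤ -1 * m := mul_le_mul_of_nonneg_right (by omega) (by positivity)
      omega
    · have : 1 * (m : ℤ) ≤ t * m := mul_le_mul_of_nonneg_right (by omega) (by positivity)
      omega
  subst ht0
  omega

theorem image_residue_sub_range (x : ℤ) :
    (Finset.range m).image (fun j : ℕ => residue m (x - j)) = Finset.univ := by
  rw [← Finset.card_eq_iff_eq_univ, Finset.card_image_of_injOn (residue_sub_injOn x)]
  simp

end Residue

/-! ### Arc products and mean passage times. -/

section ArcProducts

variable {m : ℕ} [NeZero m]

/-- The product of `ρ` over the `k` consecutive residues ending at `x`. -/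
def arcProd (ρ : Fin m → ℝ) (k : ℕ) (x : ℤ) : ℝ :=
  ∏ j ∈ Finset.range k, ρ (residue m (x - j))

/-- The sum, over all arcs of length `k` of the cycle, of the product of `ρ` over the arc. -/
def arcSum (ρ : Fin m → ℝ) (k : ℕ) : ℝ :=
  ∑ i : Fin m, arcProd ρ k (i : ℕ)

theorem arcProd_congr (ρ : Fin m → ℝ) (k : ℕ) {x y : ℤ} (h : residue m x = residue m y) :
    arcProd ρ k x = arcProd ρ k y := by
  obtain ⟨t, rfl⟩ := residue_eq_iff.1 h
  refine Finset.prod_congr rfl fun j _ => ?_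
  rw [show y + t * m - j = y - j + t * m by ring, residue_add_mul]

theorem arcProd_zero (ρ : Fin m → ℝ) (x : ℤ) : arcProd ρ 0 x = 1 := by simp [arcProd]

theorem arcProd_succ (ρ : Fin m → ℝ) (k : ℕ) (x : ℤ) :
    arcProd ρ (k + 1) x = ρ (residue m x) * arcProd ρ k (x - 1) := by
  rw [arcProd, Finset.prod_range_succ', mul_comm]
  congr 1
  · simp
  · refine Finset.prod_congr rfl fun j _ => ?_
    congr 2
    push_cast
    ring

theorem arcProd_full (ρ : Fin m → ℝ) (x : ℤ) : arcProd ρ m x = ∏ i, ρ i := by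
  rw [← image_residue_sub_range x, Finset.prod_image (residue_sub_injOn x), arcProd]

theorem arcProd_pos {ρ : Fin m → ℝ} (hρ : ∀ i, 0 < ρ i) (k : ℕ) (x : ℤ) : 0 < arcProd ρ k x :=
  Finset.prod_pos fun _ _ => hρ _

theorem arcSum_pos {ρ : Fin m → ℝ} (hρ : ∀ i, 0 < ρ i) (k : ℕ) : 0 < arcSum ρ k :=
  Finset.sum_pos (fun _ _ => arcProd_pos hρ k _) Finset.univ_nonempty

/-- `(1 - ∏ ρ)` times the mean time that the chain with odds `ρ` takes to go from `x` to
`x + 1`. -/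
def passageWeight (ρ : Fin m → ℝ) (x : ℤ) : ℝ :=
  ∑ k ∈ Finset.range m, (arcProd ρ k x + arcProd ρ (k + 1) x)

/-- `(1 - ∏ ρ)` times the mean time that the chain with odds `ρ` takes to advance by a full
period. -/
def periodWeight (ρ : Fin m → ℝ) : ℝ :=
  ∑ k ∈ Finset.range m, (arcSum ρ k + arcSum ρ (k + 1))

theorem passageWeight_congr (ρ : Fin m → ℝ) {x y : ℤ} (h : residue m x = residue m y) :
    passageWeight ρ x = passageWeight ρ y := by
  simp only [passageWeight, arcProd_congr ρ _ h]

/-- First-step analysis `T x = 1 + ρ x + ρ x * T (x - 1)` for the mean passage time, cleared of the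
factor `1 - ∏ ρ`. Multiplying by `ρ x` lengthens an arc by one, so the sums telescope. -/
theorem passageWeight_sub (ρ : Fin m → ℝ) (x : ℤ) :
    passageWeight ρ x - ρ (residue m x) * passageWeight ρ (x - 1) =
      (1 - ∏ i, ρ i) * (1 + ρ (residue m x)) := by
  have h : ∀ n : ℕ, ∑ k ∈ Finset.range n, (arcProd ρ k x + arcProd ρ (k + 1) x) -
      ρ (residue m x) * ∑ k ∈ Finset.range n, (arcProd ρ k (x - 1) + arcProd ρ (k + 1) (x - 1)) =
      arcProd ρ 0 x + arcProd ρ 1 x - arcProd ρ n x - arcProd ρ (n + 1) x := by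
    intro n
    induction n with
    | zero => simp
    | succ n ih =>
      rw [Finset.sum_range_succ, Finset.sum_range_succ, mul_add, mul_add,
        ← arcProd_succ, ← arcProd_succ]
      linarith
  rw [passageWeight, passageWeight, h m, arcProd_succ ρ m, arcProd_succ ρ 0, arcProd_full,
    arcProd_full, arcProd_zero, arcProd_zero]
  ring

theorem sum_passageWeight (ρ : Fin m → ℝ) :
    ∑ i : Fin m, passageWeight ρ (i : ℕ) = periodWeight ρ := by
  simp only [passageWeight, periodWeight, arcSum]
  rw [Finset.sum_comm]
  exact Finset.sum_congr rfl fun k _ => Finset.sum_add_distrib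

theorem periodWeight_pos {ρ : Fin m → ℝ} (hρ : ∀ i, 0 < ρ i) : 0 < periodWeight ρ :=
  Finset.sum_pos (fun k _ => add_pos (arcSum_pos hρ k) (arcSum_pos hρ (k + 1)))
    ⟨0, Finset.mem_range.2 (Nat.pos_of_ne_zero (NeZero.ne m))⟩

/-- A periodic function on `ℤ` with mean `1` is the gradient of a function at bounded distance
from the identity. -/
theorem exists_primitive_of_periodic {D : ℤ → ℝ} (hD : ∀ x, D x = D (residue m x : ℕ))
    (hsum : ∑ i : Fin m, D (i : ℕ) = m) :
    ∃ (h : ℤ → ℝ) (B : ℝ), (∀ x, h (x + 1) - h x = D x) ∧ ∀ x : ℤ, |h x - x| ≤ B := by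
  have hsum' : ∑ j ∈ Finset.range m, (D j - 1) = 0 := by
    rw [Finset.sum_sub_distrib, Finset.sum_range (fun j : ℕ => D j), hsum]
    simp
  -- Since `D - 1` sums to zero over a period, `g m = g 0`, and `g` is consistent when the residue
  -- wraps around.
  set g : ℕ → ℝ := fun i => ∑ j ∈ Finset.range i, (D j - 1) with hg
  refine ⟨fun x => x + g (residue m x), ∑ i : Fin m, |g i|, fun x => ?_, fun x => ?_⟩
  · have hstep : g (residue m (x + 1)) = g (residue m x + 1) := by
      obtain ⟨t, ht⟩ := exists_eq_residue_add (m := m) x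
      have hlt := (residue m x).2
      rcases Nat.lt_or_ge ((residue m x : ℕ) + 1) m with h | h
      · have : residue m (x + 1) = (⟨(residue m x : ℕ) + 1, h⟩ : Fin m) := by
          rw [← residue_natCast_val (⟨(residue m x : ℕ) + 1, h⟩ : Fin m), residue_eq_iff]
          exact ⟨-t, by push_cast; linarith⟩
        rw [this]
      · have hm : (residue m x : ℕ) + 1 = m := by omega
        have hm0 : 0 < m := Nat.pos_of_ne_zero (NeZero.ne m)
        have : residue m (x + 1) = (⟨0, hm0⟩ : Fin m) := by
          rw [← residue_natCast_val (⟨0, hm0⟩ : Fin m), residue_eq_iff]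
          refine ⟨1 - t, ?_⟩
          have : ((residue m x : ℕ) : ℤ) + 1 = m := by exact_mod_cast hm
          push_cast
          linarith
        rw [this, hm]
        exact hsum'.symm
    simp only [hstep]
    simp only [hg, Finset.sum_range_succ]
    rw [hD x]
    push_cast
    ring
  · simp only [add_sub_cancel_left]
    exact Finset.single_le_sum (f := fun i : Fin m => |g i|) (fun i _ => abs_nonneg _)
      (Finset.mem_univ _)

end ArcProducts

/-! ### The formula for the speed. -/

section VelocityFormula

variable {m : ℕ} [NeZero m] (p : Fin m → Set.Ioo (0 : ℝ) 1)

/-- The odds `(1 - p i) / p i` of a downward step. -/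
noncomputable def odds {m : ℕ} (p : Fin m → Set.Ioo (0 : ℝ) 1) (i : Fin m) : ℝ :=
  (1 - (p i : ℝ)) / (p i : ℝ)

theorem odds_pos {m : ℕ} (p : Fin m → Set.Ioo (0 : ℝ) 1) (i : Fin m) : 0 < odds p i :=
  div_pos (sub_pos.2 (p i).2.2) (p i).2.1

theorem hasVelocity_formula :
    HasVelocity p (m * (1 - gammaProd p) / periodWeight (odds p)) := by
  intro x₀
  have hN := periodWeight_pos (odds_pos p)
  set N := periodWeight (odds p) with hNdef
  set v : ℝ := m * (1 - gammaProd p) / N with hv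
  -- Proportional to the mean passage time from `x` to `x + 1`, scaled to have mean `1` over a
  -- period.
  set D : ℤ → ℝ := fun x => m / N * passageWeight (odds p) x with hDdef
  have hD : ∀ x, D x = D (residue m x : ℕ) := fun x => by
    simp only [hDdef]
    rw [passageWeight_congr (odds p) (residue_natCast_val (residue m x)).symm]
  have hsum : ∑ i : Fin m, D (i : ℕ) = m := by
    simp only [hDdef]
    rw [← Finset.mul_sum, sum_passageWeight, ← hNdef]
    field_simp
  obtain ⟨h, B, hh, hB⟩ := exists_primitive_of_periodic hD hsum
  have hh' : ∀ x, h (x - 1) - h x = -D (x - 1) := fun x => by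
    rw [← hh (x - 1), sub_add_cancel]
    ring
  have hDb : ∀ x, |D x| ≤ ∑ i : Fin m, |D (i : ℕ)| := fun x => by
    rw [hD x]
    exact Finset.single_le_sum (f := fun i : Fin m => |D (i : ℕ)|) (fun i _ => abs_nonneg _)
      (Finset.mem_univ _)
  refine ae_tendsto_div (h := h) (v := v) (c := ∑ i : Fin m, |D (i : ℕ)| + |v| + 1) (B := B)
    ?_ ?_ ?_ x₀ ?_ hB
  · intro x
    have hp := (p (residue m x)).2
    have hp0 := hp.1.ne'
    rw [hh x, hh' x]
    have key := passageWeight_sub (odds p) x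
    have e1 : (p (residue m x) : ℝ) * odds p (residue m x) = 1 - p (residue m x) := by
      rw [odds]; field_simp
    have e2 : ∏ i, odds p i = gammaProd p := rfl
    have hvN : v = m / N * (1 - gammaProd p) := by rw [hv]; ring
    rw [e2] at key
    simp only [hDdef]
    rw [hvN]
    linear_combination (m / N * (p (residue m x) : ℝ)) * key +
      (m / N * (passageWeight (odds p) (x - 1) + (1 - gammaProd p))) * e1
  · intro x
    rw [hh x]
    have := abs_sub (D x) v
    have := hDb x
    linarith
  · intro x
    rw [hh' x]
    have h1 := abs_sub (-D (x - 1)) v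
    rw [abs_neg] at h1
    have := hDb (x - 1)
    linarith
  · have : 0 ≤ ∑ i : Fin m, |D (i : ℕ)| := Finset.sum_nonneg fun i _ => abs_nonneg _
    have := abs_nonneg v
    linarith

end VelocityFormula

/-! ### Polarization with respect to an involution. -/

section TwoPointRearrangement

variable {ι : Type*} [Fintype ι] [DecidableEq ι] {R : ι → ι}

/-- Squaring counts each factor once at `x` and once at `R x`, so products can be compared pair by
pair even when `W` is not `R`-invariant. -/
theorem sq_prod_eq_prod_involutive (hR : Function.Involutive R) (W : Finset ι) (a : ι → ℝ) :
    (∏ x ∈ W, a x) ^ 2 =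
      ∏ x, (if x ∈ W then a x else 1) * (if R x ∈ W then a (R x) else 1) := by
  have h1 : ∏ x ∈ W, a x = ∏ x, if x ∈ W then a x else 1 := by
    rw [Finset.prod_ite_mem, Finset.univ_inter]
  have h2 : ∏ x, (if R x ∈ W then a (R x) else 1) = ∏ x, if x ∈ W then a x else 1 :=
    Equiv.prod_comp hR.toPerm (fun x => if x ∈ W then a x else 1)
  rw [Finset.prod_mul_distrib, h2, ← h1, sq]

theorem prod_le_prod_of_involutive (hR : Function.Involutive R) {H : ι → Prop}
    (hfix : ∀ x, ¬H x → ¬H (R x) → R x = x) {a b : ι → ℝ} (ha : ∀ x, 0 < a x)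
    (hb : ∀ x, 0 < b x) (hab : ∀ x, H x → a x ≤ b x)
    (hab' : ∀ x, H x → a x * a (R x) ≤ b x * b (R x)) (heq : ∀ x, R x = x → a x ≤ b x)
    {W : Finset ι} (hW : ∀ x, H x → R x ∈ W → x ∈ W) :
    ∏ x ∈ W, a x ≤ ∏ x ∈ W, b x := by
  refine le_of_sq_le_sq ?_ (Finset.prod_pos fun x _ => hb x).le
  rw [sq_prod_eq_prod_involutive hR, sq_prod_eq_prod_involutive hR]
  have hpos : ∀ (c : ι → ℝ), (∀ x, 0 < c x) → ∀ x,
      0 < if x ∈ W then c x else 1 := fun c hc x => by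
    split_ifs
    · exact hc x
    · exact one_pos
  have hH : ∀ x, H x → (if x ∈ W then a x else 1) * (if R x ∈ W then a (R x) else 1) ≤
      (if x ∈ W then b x else 1) * (if R x ∈ W then b (R x) else 1) := by
    intro x hx
    by_cases h1 : R x ∈ W
    · simpa [h1, hW x hx h1] using hab' x hx
    · by_cases h2 : x ∈ W
      · simpa [h1, h2] using hab x hx
      · simp [h1, h2]
  refine Finset.prod_le_prod (fun x _ => (mul_pos (hpos a ha x) (hpos a ha (R x))).le)
    fun x _ => ?_
  by_cases hx : H x
  · exact hH x hx
  by_cases hx' : H (R x)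
  · have := hH (R x) hx'
    rw [hR x] at this
    rwa [mul_comm, mul_comm (if x ∈ W then b x else 1)]
  · have hRx := hfix x hx hx'
    rw [hRx]
    by_cases h : x ∈ W
    · simpa [h] using mul_le_mul (heq x hRx) (heq x hRx) (ha x).le (hb x).le
    · simp [h]

/-- `U (U + V - u - v) = (U - u) (U - v)`. -/
theorem add_le_add_of_mul_eq_mul {u v U V : ℝ} (hU : 0 < U) (hu : u ≤ U) (hv : v ≤ U)
    (h : U * V = u * v) : u + v ≤ U + V := by
  refine le_of_mul_le_mul_left ?_ hU
  nlinarith [mul_nonneg (sub_nonneg.2 hu) (sub_nonneg.2 hv)]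

/-- `g` is the two-point rearrangement of `f` with respect to the involution `R`, the larger
value of each pair being put in `H`. -/
structure IsPolarization (R : ι → ι) (H : ι → Prop) (f g : ι → ℝ) : Prop where
  max_eq : ∀ x, H x → g x = max (f x) (f (R x))
  min_eq : ∀ x, H x → g (R x) = min (f x) (f (R x))
  fixed : ∀ x, R x = x → g x = f x

variable {H : ι → Prop} {f g : ι → ℝ}

/-- Polarization preserves `f x * f (R x)`, hence the product of the two summands. As `W` prefers
the `H` side, where `g` is larger, `∏ g` over `W` dominates both products of `f`. -/
theorem IsPolarization.prod_add_prod_le_of_forall (hg : IsPolarization R H f g)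
    (hR : Function.Involutive R) (hfix : ∀ x, ¬H x → ¬H (R x) → R x = x)
    (hf : ∀ x, 0 < f x) (hgpos : ∀ x, 0 < g x)
    {W : Finset ι} (hW : ∀ x, H x → R x ∈ W → x ∈ W) :
    ∏ x ∈ W, f x + ∏ x ∈ W, f (R x) ≤ ∏ x ∈ W, g x + ∏ x ∈ W, g (R x) := by
  have hmul : ∀ x, H x → g x * g (R x) = f x * f (R x) := fun x hx => by
    rw [hg.max_eq x hx, hg.min_eq x hx, max_mul_min]
  have hmul' : ∀ x, g x * g (R x) = f x * f (R x) := by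
    intro x
    by_cases hx : H x
    · exact hmul x hx
    by_cases hx' : H (R x)
    · have := hmul (R x) hx'
      rw [hR x] at this
      linarith
    · have hRx := hfix x hx hx'
      rw [hRx, hg.fixed x hRx]
  refine add_le_add_of_mul_eq_mul (Finset.prod_pos fun x _ => hgpos x) ?_ ?_ ?_
  · exact prod_le_prod_of_involutive hR hfix hf hgpos
      (fun x hx => by rw [hg.max_eq x hx]; exact le_max_left _ _)
      (fun x _ => (hmul' x).ge) (fun x hx => (hg.fixed x hx).ge) hW
  · exact prod_le_prod_of_involutive hR hfix (fun x => hf (R x)) hgpos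
      (fun x hx => by rw [hg.max_eq x hx]; exact le_max_right _ _)
      (fun x _ => by rw [hR x, hmul' x, mul_comm])
      (fun x hx => by rw [hx]; exact (hg.fixed x hx).ge) hW
  · rw [← Finset.prod_mul_distrib, ← Finset.prod_mul_distrib]
    exact Finset.prod_congr rfl fun x _ => hmul' x

/-- Polarization increases `∏ f` over `W` plus its reflection, provided that `W` does not leave
`H` in one pair and enter it in another. -/
theorem IsPolarization.prod_add_prod_le (hg : IsPolarization R H f g)
    (hR : Function.Involutive R) (hfix : ∀ x, ¬H x → ¬H (R x) → R x = x)
    (hf : ∀ x, 0 < f x) (hgpos : ∀ x, 0 < g x) {W : Finset ι}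
    (hW : ∀ x y, H x → H y → x ∈ W → R y ∈ W → R x ∈ W ∨ y ∈ W) :
    ∏ x ∈ W, f x + ∏ x ∈ W, f (R x) ≤ ∏ x ∈ W, g x + ∏ x ∈ W, g (R x) := by
  by_cases h : ∀ y, H y → R y ∈ W → y ∈ W
  · exact hg.prod_add_prod_le_of_forall hR hfix hf hgpos h
  -- Some pair meets `W` only outside `H`. By `hW` no pair meets `W` only inside `H`, so `R(W)`
  -- satisfies the one-sided condition, and replacing `W` by `R(W)` merely swaps the summands.
  · push Not at h
    obtain ⟨y, hy, hyW, hyW'⟩ := h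
    have hmem : ∀ x, R x ∈ W.image R ↔ x ∈ W := fun x => by
      rw [Finset.mem_image]
      exact ⟨fun ⟨z, hz, hzx⟩ => hR.injective hzx ▸ hz, fun hx => ⟨x, hx, rfl⟩⟩
    have hmem' : ∀ x, x ∈ W.image R ↔ R x ∈ W := fun x => by rw [← hmem (R x), hR x]
    have key := hg.prod_add_prod_le_of_forall hR hfix hf hgpos (W := W.image R)
      (fun x hx hxW => (hmem' x).2 ((hW x y hx hy ((hmem x).1 hxW) hyW).resolve_right hyW'))
    simp only [Finset.prod_image hR.injective.injOn, hR _] at key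
    linarith

end TwoPointRearrangement

/-! ### Reflections of the cycle and arc sums. -/

section Reflection

variable {m : ℕ} [NeZero m]

/-- The reflection `x ↦ c - x` of the cycle of residues modulo `m`. -/
def reflection (m : ℕ) [NeZero m] (c : ℤ) (z : Fin m) : Fin m :=
  residue m (c - (z : ℕ))

/-- The residues of the integers strictly between the two centres `c / 2` and `(c + m) / 2` of the
reflection `x ↦ c - x`. -/
def upperHalf (m : ℕ) [NeZero m] (c : ℤ) (z : Fin m) : Prop :=
  ∃ y : ℤ, c < 2 * y ∧ 2 * y < c + m ∧ residue m y = z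

theorem reflection_residue (c x : ℤ) : reflection m c (residue m x) = residue m (c - x) := by
  obtain ⟨t, ht⟩ := exists_eq_residue_add (m := m) x
  rw [reflection, residue_eq_iff]
  exact ⟨-t, by rw [ht]; ring⟩

theorem reflection_involutive (c : ℤ) : Function.Involutive (reflection m c) := by
  intro z
  obtain ⟨x, rfl⟩ := residue_surjective z
  rw [reflection_residue, reflection_residue, sub_sub_cancel]

theorem not_upperHalf_reflection {c : ℤ} {z : Fin m} (hz : upperHalf m c z) :
    ¬upperHalf m c (reflection m c z) := by
  obtain ⟨y, h1, h2, rfl⟩ := hz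
  rintro ⟨w, h3, h4, h5⟩
  rw [reflection_residue, residue_eq_iff] at h5
  obtain ⟨t, rfl⟩ := h5
  have hm : (0 : ℤ) < m := by omega
  have ht0 : 0 < t := by
    by_contra h
    have : t * (m : ℤ) ≤ 0 * m := mul_le_mul_of_nonneg_right (by omega) hm.le
    omega
  have : 1 * (m : ℤ) ≤ t * m := mul_le_mul_of_nonneg_right (by omega) hm.le
  omega

/-- Only the centres `c / 2` and `(c + m) / 2`, when they are integers, lie in neither open half. -/
theorem reflection_eq_self_of_not_upperHalf {c : ℤ} {z : Fin m} (hz : ¬upperHalf m c z)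
    (hz' : ¬upperHalf m c (reflection m c z)) : reflection m c z = z := by
  obtain ⟨x, rfl⟩ := residue_surjective z
  have hm : (0 : ℤ) < 2 * m := by
    have : 0 < m := Nat.pos_of_ne_zero (NeZero.ne m)
    omega
  obtain ⟨y, hxy, h1, h2⟩ : ∃ y : ℤ, residue m x = residue m y ∧ c ≤ 2 * y ∧
      2 * y < c + 2 * m := by
    refine ⟨x - (2 * x - c) / (2 * m) * m, residue_eq_iff.2
      ⟨(2 * x - c) / (2 * m), by ring⟩, ?_, ?_⟩
    · have := Int.emod_nonneg (2 * x - c) hm.ne'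
      have := Int.mul_ediv_add_emod (2 * x - c) (2 * m)
      linarith
    · have := Int.emod_lt_of_pos (2 * x - c) hm
      have := Int.mul_ediv_add_emod (2 * x - c) (2 * m)
      linarith
  rw [hxy] at hz hz' ⊢
  rw [reflection_residue] at hz' ⊢
  rcases h1.eq_or_lt with h | h
  · congr 1
    omega
  · rcases lt_trichotomy (2 * y) (c + m) with h' | h' | h'
    · exact absurd ⟨y, h, h', rfl⟩ hz
    · exact residue_eq_iff.2 ⟨-1, by linarith⟩
    · exact absurd ⟨c - y + 1 * m, by linarith, by linarith, residue_add_mul _ _⟩ hz'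

theorem mem_image_residue_iff {k : ℕ} {a : ℤ} {z : Fin m} :
    z ∈ (Finset.range k).image (fun j : ℕ => residue m (a - j)) ↔
      ∃ w : ℤ, a - k < w ∧ w ≤ a ∧ residue m w = z := by
  rw [Finset.mem_image]
  constructor
  · rintro ⟨j, hj, rfl⟩
    have := Finset.mem_range.1 hj
    exact ⟨a - j, by omega, by omega, rfl⟩
  · rintro ⟨w, h1, h2, rfl⟩
    refine ⟨(a - w).toNat, Finset.mem_range.2 (by omega), ?_⟩
    congr 1
    omega

/-- An arc that contains `x` and the reflection of `y` contains `y` or the reflection of `x`. -/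
theorem arc_noncrossing {c : ℤ} {k : ℕ} (hk : k ≤ m) (a : ℤ) {x y : Fin m}
    (hx : upperHalf m c x) (hy : upperHalf m c y)
    (hxW : x ∈ (Finset.range k).image (fun j : ℕ => residue m (a - j)))
    (hyW : reflection m c y ∈ (Finset.range k).image (fun j : ℕ => residue m (a - j))) :
    reflection m c x ∈ (Finset.range k).image (fun j : ℕ => residue m (a - j)) ∨
      y ∈ (Finset.range k).image (fun j : ℕ => residue m (a - j)) := by
  obtain ⟨X, hX1, hX2, rfl⟩ := hx
  obtain ⟨Y, hY1, hY2, rfl⟩ := hy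
  rw [reflection_residue, mem_image_residue_iff] at hyW ⊢
  rw [mem_image_residue_iff] at hxW ⊢
  obtain ⟨w, hw1, hw2, hw3⟩ := hxW
  obtain ⟨u, hu1, hu2, hu3⟩ := hyW
  obtain ⟨s, rfl⟩ := residue_eq_iff.1 hw3
  obtain ⟨r, rfl⟩ := residue_eq_iff.1 hu3
  have hm : (0 : ℤ) < m := by omega
  obtain ⟨t, rfl⟩ : ∃ t, r = s + t := ⟨r - s, by ring⟩
  rw [add_mul] at hu1 hu2
  have ht0 : 0 ≤ t := by
    by_contra h
    have : t * (m : ℤ) ≤ -1 * m := mul_le_mul_of_nonneg_right (by omega) hm.le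
    omega
  have ht1 : t ≤ 1 := by
    by_contra h
    have : 2 * (m : ℤ) ≤ t * m := mul_le_mul_of_nonneg_right (by omega) hm.le
    omega
  -- Up to translation by `s * m`, the arc runs across the centre `c / 2` when `t = 0` and `(c + m)
  -- / 2` when `t = 1`. The pair nearer to that centre lies wholly in the arc.
  obtain rfl | rfl : t = 0 ∨ t = 1 := by omega
  · rcases le_total Y X with h | h
    · exact Or.inr ⟨Y + s * m, by linarith, by linarith, residue_add_mul _ _⟩
    · exact Or.inl ⟨c - X + s * m, by linarith, by linarith, residue_add_mul _ _⟩
  · rcases le_total X Y with h | h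
    · exact Or.inr ⟨Y + s * m, by linarith, by linarith, residue_add_mul _ _⟩
    · exact Or.inl ⟨c - X + (s + 1) * m, by linarith, by linarith, residue_add_mul _ _⟩

theorem arcProd_eq_prod_image {k : ℕ} (hk : k ≤ m) (f : Fin m → ℝ) (a : ℤ) :
    arcProd f k a = ∏ z ∈ (Finset.range k).image (fun j : ℕ => residue m (a - j)), f z := by
  rw [Finset.prod_image ((residue_sub_injOn a).mono
    (Finset.coe_subset.2 (Finset.range_mono hk))), arcProd]

theorem arcProd_comp_reflection (f : Fin m → ℝ) (c : ℤ) (k : ℕ) (a : ℤ) :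
    arcProd (f ∘ reflection m c) k a = arcProd f k (c + k - 1 - a) := by
  rw [arcProd, arcProd, ← Finset.prod_range_reflect]
  refine Finset.prod_congr rfl fun j hj => ?_
  have := Finset.mem_range.1 hj
  rw [Function.comp_apply, reflection_residue]
  congr 2
  omega

theorem arcSum_comp_reflection (f : Fin m → ℝ) (c : ℤ) (k : ℕ) :
    arcSum (f ∘ reflection m c) k = arcSum f k := by
  rw [arcSum, arcSum, ← Equiv.sum_comp (reflection_involutive (m := m) (c + k - 1)).toPerm]
  refine Finset.sum_congr rfl fun i _ => ?_
  rw [arcProd_comp_reflection]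
  exact arcProd_congr f k ((reflection_involutive _ i).trans (residue_natCast_val i).symm)

/-- Reflection permutes the arcs of length `k`, so twice the arc sum is a sum over arcs of a product
plus its reflection; `arc_noncrossing` lets polarization act on each term. -/
theorem IsPolarization.arcSum_le {c : ℤ} {k : ℕ} (hk : k ≤ m) {f g : Fin m → ℝ}
    (hg : IsPolarization (reflection m c) (upperHalf m c) f g) (hf : ∀ x, 0 < f x)
    (hgpos : ∀ x, 0 < g x) : arcSum f k ≤ arcSum g k := by
  have h2 : arcSum f k + arcSum (f ∘ reflection m c) k ≤
      arcSum g k + arcSum (g ∘ reflection m c) k := by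
    simp only [arcSum, ← Finset.sum_add_distrib]
    refine Finset.sum_le_sum fun i _ => ?_
    simp only [arcProd_eq_prod_image hk]
    exact hg.prod_add_prod_le (reflection_involutive c)
      (fun x => reflection_eq_self_of_not_upperHalf) hf hgpos
      fun x y hx hy => arc_noncrossing hk _ hx hy
  rw [arcSum_comp_reflection, arcSum_comp_reflection] at h2
  linarith

end Reflection

/-! ### Optimality of the greedy arrangement. -/

section Greedy

variable {m : ℕ} [NeZero m]

open Classical in
/-- Exchange the points of those pairs `{z, R z}` in which `τ` has its larger value outside
`H`. -/
noncomputable def polarizingSwap {ι : Type*} (R : ι → ι) (H : ι → Prop) {α : Type*}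
    [LinearOrder α] (τ : ι → α) (z : ι) : ι :=
  if (H z ∧ τ z < τ (R z)) ∨ (H (R z) ∧ τ (R z) < τ z) then R z else z

theorem polarizingSwap_involutive {ι α : Type*} [LinearOrder α] {R : ι → ι}
    (hR : Function.Involutive R) (H : ι → Prop) (τ : ι → α) :
    Function.Involutive (polarizingSwap R H τ) := by
  intro z
  by_cases h : (H z ∧ τ z < τ (R z)) ∨ (H (R z) ∧ τ (R z) < τ z)
  · rw [show polarizingSwap R H τ z = R z from if_pos h]
    have h' : (H (R z) ∧ τ (R z) < τ (R (R z))) ∨ (H (R (R z)) ∧ τ (R (R z)) < τ (R z)) := by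
      rw [hR z]
      exact h.symm
    rw [show polarizingSwap R H τ (R z) = R (R z) from if_pos h', hR z]
  · rw [show polarizingSwap R H τ z = z from if_neg h,
      show polarizingSwap R H τ z = z from if_neg h]

theorem isPolarization_comp_polarizingSwap {ι α : Type*} [LinearOrder α] {R : ι → ι}
    (hR : Function.Involutive R) {H : ι → Prop} (hH : ∀ z, H z → ¬H (R z)) (τ : ι → α)
    {F : α → ℝ} (hF : Monotone F) :
    IsPolarization R H (F ∘ τ) (F ∘ τ ∘ polarizingSwap R H τ) := by
  refine ⟨fun z hz => ?_, fun z hz => ?_, fun z hz => ?_⟩ <;>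
    simp only [Function.comp_apply, polarizingSwap]
  · rw [← hF.map_max]
    rcases lt_or_ge (τ z) (τ (R z)) with h | h
    · rw [if_pos (Or.inl ⟨hz, h⟩), max_eq_right h.le]
    · rw [if_neg (by simp [hH z hz, h]), max_eq_left h]
  · rw [← hF.map_min, hR z]
    rcases lt_or_ge (τ z) (τ (R z)) with h | h
    · rw [if_pos (Or.inr ⟨hz, h⟩), min_eq_left h.le]
    · rw [if_neg (by simp [hH z hz, h]), min_eq_right h]
  · rw [hz, ite_self]

/-- The rearrangement inequality on each pair `{x, R x}`; it provides a potential that strictly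
increases under any effective polarization. -/
theorem sum_mul_lt_sum_mul_polarizingSwap {ι : Type*} [Fintype ι] {R : ι → ι}
    (hR : Function.Involutive R) {H : ι → Prop}
    {G τ : ι → ℕ} (hG : ∀ z, H z → G (R z) < G z) {z : ι} (hz : H z) (hτ : τ z < τ (R z)) :
    ∑ x, G x * τ x < ∑ x, G x * τ (polarizingSwap R H τ x) := by
  have hsum : ∀ f : ι → ℕ, 2 * ∑ x, f x = ∑ x, (f x + f (R x)) := fun f => by
    rw [Finset.sum_add_distrib, two_mul]
    congr 1
    exact (Equiv.sum_comp hR.toPerm f).symm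
  refine lt_of_mul_lt_mul_left (a := 2) ?_ (by norm_num)
  rw [hsum, hsum]
  have hswap : ∀ x, (H x ∧ τ x < τ (R x)) →
      G x * τ x + G (R x) * τ (R x) < G x * τ (polarizingSwap R H τ x) +
        G (R x) * τ (polarizingSwap R H τ (R x)) := by
    rintro x ⟨hx, hlt⟩
    have e1 : polarizingSwap R H τ x = R x := if_pos (Or.inl ⟨hx, hlt⟩)
    have e2 : polarizingSwap R H τ (R x) = x := by
      rw [← e1, polarizingSwap_involutive hR]
    rw [e1, e2]
    have := hG x hx
    obtain ⟨a, ha⟩ := Nat.exists_eq_add_of_lt this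
    obtain ⟨b, hb⟩ := Nat.exists_eq_add_of_lt hlt
    rw [ha, hb]
    nlinarith
  refine Finset.sum_lt_sum (fun x _ => ?_) ⟨z, Finset.mem_univ z, hswap z ⟨hz, hτ⟩⟩
  by_cases h : (H x ∧ τ x < τ (R x))
  · exact (hswap x h).le
  by_cases h' : (H (R x) ∧ τ (R x) < τ x)
  · have := hswap (R x) (by rwa [hR x])
    rw [hR x] at this
    linarith
  · have e1 : polarizingSwap R H τ x = x := if_neg (by tauto)
    have e2 : polarizingSwap R H τ (R x) = R x := if_neg (by rw [hR x]; tauto)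
    rw [e1, e2]

/-- With the next lemma: `greedyInv` takes the values `0, 1, 2, 3, …` along the zigzag `0, -1, 1,
-2, …`. -/
theorem greedyInv_residue_natCast {y : ℕ} (hy : 2 * y < m) :
    (greedyInv m (residue m y) : ℕ) = 2 * y := by
  have h : residue m y = (⟨y, by omega⟩ : Fin m) :=
    residue_natCast_val (⟨y, by omega⟩ : Fin m)
  rw [h, greedyInv, dif_pos hy]

theorem greedyInv_residue_neg_one_sub {y : ℕ} (hy : 2 * y + 1 < m) :
    (greedyInv m (residue m (-1 - y)) : ℕ) = 2 * y + 1 := by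
  have h : residue m (-1 - y) = (⟨m - 1 - y, by omega⟩ : Fin m) := by
    rw [← residue_natCast_val (⟨m - 1 - y, by omega⟩ : Fin m), residue_eq_iff]
    refine ⟨-1, ?_⟩
    simp only
    omega
  rw [h, greedyInv, dif_neg (by simp only; omega)]
  simp only
  omega

theorem greedyInv_reflection_zero_lt {z : Fin m} (hz : upperHalf m 0 z) :
    greedyInv m (reflection m 0 z) < greedyInv m z := by
  obtain ⟨y, h1, h2, rfl⟩ := hz
  obtain ⟨n, rfl⟩ : ∃ n : ℕ, y = n + 1 := ⟨(y - 1).toNat, by omega⟩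
  rw [Fin.lt_def, reflection_residue, show (0 : ℤ) - (n + 1) = -1 - (n : ℕ) by ring,
    greedyInv_residue_neg_one_sub (by omega), show (n : ℤ) + 1 = (n + 1 : ℕ) by norm_num,
    greedyInv_residue_natCast (by omega)]
  omega

/-- Modulo `m` this is the reflection `x ↦ -1 - x`; writing its constant as `-1 - m` selects the
half of negative representatives, which carries the larger greedy values. -/
theorem greedyInv_reflection_neg_lt {z : Fin m} (hz : upperHalf m (-1 - m) z) :
    greedyInv m (reflection m (-1 - m) z) < greedyInv m z := by
  obtain ⟨y, h1, h2, rfl⟩ := hz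
  obtain ⟨n, rfl⟩ : ∃ n : ℕ, y = -1 - n := ⟨(-1 - y).toNat, by omega⟩
  have h3 : residue m (-1 - m - (-1 - n)) = residue m n :=
    residue_eq_iff.2 ⟨-1, by ring⟩
  rw [Fin.lt_def, reflection_residue, h3, greedyInv_residue_neg_one_sub (by omega),
    greedyInv_residue_natCast (by omega)]
  omega

/-- An arrangement that is polarized with respect to both reflections generating the zigzag
`0, -1, 1, -2, 2, …` is the greedy one. -/
theorem eq_greedyInv_of_polarized {τ : Fin m → Fin m} (hτ : Function.Bijective τ)
    (h0 : ∀ z, upperHalf m 0 z → τ (reflection m 0 z) < τ z)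
    (h1 : ∀ z, upperHalf m (-1 - m) z → τ (reflection m (-1 - m) z) < τ z) :
    τ = greedyInv m := by
  obtain ⟨n, rfl⟩ : ∃ n, m = n + 1 := Nat.exists_eq_succ_of_ne_zero (NeZero.ne m)
  set e := (Equiv.ofBijective (greedyInv (n + 1))
    (Finite.injective_iff_bijective.1 (greedyInv_injective (n + 1)))).symm with he
  have heG : ∀ z, e (greedyInv (n + 1) z) = z := fun z =>
    Equiv.ofBijective_symm_apply_apply _ _ z
  have heven : ∀ (y : ℕ) (i : Fin (n + 1)), (i : ℕ) = 2 * y → e i = residue (n + 1) y := by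
    intro y i hi
    rw [← heG (residue (n + 1) y)]
    congr 1
    rw [Fin.ext_iff, greedyInv_residue_natCast (by omega), hi]
  have hodd : ∀ (y : ℕ) (i : Fin (n + 1)), (i : ℕ) = 2 * y + 1 →
      e i = residue (n + 1) (-1 - y) := by
    intro y i hi
    rw [← heG (residue (n + 1) (-1 - y))]
    congr 1
    rw [Fin.ext_iff, greedyInv_residue_neg_one_sub (by omega), hi]
  -- Consecutive sites of the zigzag are exchanged alternately by the two reflections, so `h1` and
  -- `h0` give every inequality between neighbours.
  have hmono : StrictMono (τ ∘ e) := by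
    rw [Fin.strictMono_iff_lt_succ]
    intro i
    have hi := i.2
    simp only [Function.comp_apply]
    obtain ⟨y, hy | hy⟩ := Nat.even_or_odd' (i : ℕ)
    · rw [heven y _ (by simpa using hy), hodd y _ (by simpa using hy)]
      have := h1 (residue (n + 1) (-1 - y)) ⟨-1 - y, by push_cast; omega, by push_cast; omega, rfl⟩
      rw [reflection_residue] at this
      rwa [show residue (n + 1) (-1 - (n + 1 : ℕ) - (-1 - y)) = residue (n + 1) y from
        residue_eq_iff.2 ⟨-1, by push_cast; ring⟩] at this
    · rw [hodd y _ (by simpa using hy),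
        heven (y + 1) _ (by rw [Fin.val_succ, hy]; ring)]
      have := h0 (residue (n + 1) (y + 1 : ℕ))
        ⟨(y + 1 : ℕ), by push_cast; omega, by push_cast; omega, rfl⟩
      rw [reflection_residue] at this
      rwa [show (0 : ℤ) - (y + 1 : ℕ) = -1 - y by push_cast; ring] at this
  have hid : τ ∘ e = id := hmono.range_inj strictMono_id |>.1 (by
    rw [(hτ.surjective.comp e.surjective).range_eq, Set.range_id])
  funext z
  have := congrFun hid (greedyInv (n + 1) z)
  simpa [heG] using this

/-- Among all arrangements of `F 0 ≤ F 1 ≤ … ≤ F (m - 1)` on a cycle, the greedy one maximizes the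
sum over all arcs of length `k` of the product over the arc. -/
theorem arcSum_comp_le_arcSum_comp_greedyInv {F : Fin m → ℝ} (hF : Monotone F)
    (hpos : ∀ i, 0 < F i) {k : ℕ} (hk : k ≤ m) (σ : Equiv.Perm (Fin m)) :
    arcSum (F ∘ σ) k ≤ arcSum (F ∘ greedyInv m) k := by
  -- Polarizing may leave the arc sum unchanged; the second coordinate, the correlation with the
  -- greedy order, breaks such ties.
  obtain ⟨τ, hmax⟩ := Finite.exists_max fun τ : Equiv.Perm (Fin m) =>
    toLex (arcSum (F ∘ τ) k, ∑ z, (greedyInv m z : ℕ) * (τ z : ℕ))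
  have hsorted : ∀ c : ℤ,
      (∀ z, upperHalf m c z → greedyInv m (reflection m c z) < greedyInv m z) →
      ∀ z, upperHalf m c z → τ (reflection m c z) < τ z := by
    intro c hG z hz
    have hR := reflection_involutive (m := m) c
    have hH : ∀ z, upperHalf m c z → ¬upperHalf m c (reflection m c z) :=
      fun z => not_upperHalf_reflection
    have hne : τ (reflection m c z) ≠ τ z := fun h => by
      have := τ.injective h
      exact hH z hz (this.symm ▸ hz)
    by_contra hlt
    have hlt' : τ z < τ (reflection m c z) := lt_of_le_of_ne (not_lt.1 hlt) hne.symm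
    set s := polarizingSwap (reflection m c) (upperHalf m c) (fun x => (τ x : ℕ)) with hs
    have hs' : s = polarizingSwap (reflection m c) (upperHalf m c) τ := rfl
    have hle : arcSum (F ∘ τ) k ≤ arcSum (F ∘ τ ∘ s) k := by
      rw [hs']
      exact (isPolarization_comp_polarizingSwap hR hH τ hF).arcSum_le hk (fun _ => hpos _)
        fun _ => hpos _
    have hlt2 := sum_mul_lt_sum_mul_polarizingSwap hR
      (G := fun x => (greedyInv m x : ℕ)) (τ := fun x => (τ x : ℕ)) hG hz hlt'
    have := hmax ((polarizingSwap_involutive hR (upperHalf m c)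
      (fun x => (τ x : ℕ))).toPerm.trans τ)
    refine absurd this (not_le.2 (Prod.Lex.toLex_lt_toLex.2 ?_))
    rcases hle.lt_or_eq with h | h
    · exact Or.inl h
    · exact Or.inr ⟨h, hlt2⟩
  have hτ : (τ : Fin m → Fin m) = greedyInv m :=
    eq_greedyInv_of_polarized τ.bijective
      (hsorted 0 fun z => greedyInv_reflection_zero_lt)
      (hsorted (-1 - m) fun z => greedyInv_reflection_neg_lt)
  rw [← hτ]
  rcases Prod.Lex.toLex_le_toLex.1 (hmax σ) with h | h
  · exact h.le
  · exact h.1.le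

end Greedy

/-! ### Comparison of speeds. -/

section Speed

variable {m : ℕ} (p : Fin m → Set.Ioo (0 : ℝ) 1)

theorem gammaProd_reorder (σ : Equiv.Perm (Fin m)) : gammaProd (reorder p σ) = gammaProd p :=
  Equiv.prod_comp σ⁻¹ fun i => (1 - (p i : ℝ)) / (p i : ℝ)

theorem odds_reorder (σ : Equiv.Perm (Fin m)) :
    odds (reorder p σ) = odds p ∘ (σ⁻¹ : Equiv.Perm (Fin m)) :=
  rfl

theorem odds_reorder_greedyPerm : odds (reorder p (greedyPerm m)) = odds p ∘ greedyInv m := by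
  rw [odds_reorder, greedyPerm, inv_inv]
  rfl

variable {p}

theorem odds_monotone (hp : Antitone p) : Monotone (odds p) := by
  intro i j hij
  have h : (p j : ℝ) ≤ p i := hp hij
  exact div_le_div₀ (sub_pos.2 (p j).2.2).le (by linarith) (p j).2.1 h

/-- The same arrangement is optimal for every arc length, so the bound holds term by term. -/
theorem periodWeight_reorder_le [NeZero m] (hp : Antitone p) (σ : Equiv.Perm (Fin m)) :
    periodWeight (odds (reorder p σ)) ≤ periodWeight (odds (reorder p (greedyPerm m))) := by
  rw [odds_reorder, odds_reorder_greedyPerm]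
  refine Finset.sum_le_sum fun k hk => ?_
  have hk' := Finset.mem_range.1 hk
  exact add_le_add
    (arcSum_comp_le_arcSum_comp_greedyInv (odds_monotone hp) (odds_pos p) hk'.le _)
    (arcSum_comp_le_arcSum_comp_greedyInv (odds_monotone hp) (odds_pos p) hk' _)

end Speed

theorem corollary1p7 (m : ℕ) [NeZero m] (hm : m ≤ 7) (p : Fin m → Set.Ioo (0 : ℝ) 1)
    (hp : Antitone p) (hγ : gammaProd p < 1) :
    (∀ σ : Equiv.Perm (Fin m), ∃ v : ℝ, 0 < v ∧ HasVelocity (reorder p σ) v) ∧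
      ∀ (σ : Equiv.Perm (Fin m)) (v₀ v : ℝ),
        HasVelocity (reorder p (greedyPerm m)) v₀ → HasVelocity (reorder p σ) v → v₀ ≤ v := by
  have hm0 : (0 : ℝ) < m := by exact_mod_cast Nat.pos_of_ne_zero (NeZero.ne m)
  have hnum : 0 < m * (1 - gammaProd p) := mul_pos hm0 (sub_pos.2 hγ)
  refine ⟨fun σ => ⟨_, ?_, hasVelocity_formula (reorder p σ)⟩, fun σ v₀ v h₀ h => ?_⟩
  · rw [gammaProd_reorder]
    exact div_pos hnum (periodWeight_pos (odds_pos _))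
  · rw [h₀.unique (hasVelocity_formula _), h.unique (hasVelocity_formula _), gammaProd_reorder,
      gammaProd_reorder]
    exact div_le_div_of_nonneg_left hnum.le (periodWeight_pos (odds_pos _))
      (periodWeight_reorder_le hp σ)
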